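/- **Setting.** Let $A:[t_0,\infty)\to\mathbb R^{n\times n}$ and $B:[t_0,\infty)\to\mathbb R^{n\times m}$ be integrable on every compact interval of $[t_0,\infty)$, let $U\subset\mathbb R^m$ and $S\subset\mathbb R^n$ be convex, compact and nonempty, and let $t_f>t_0$. Let $\mathcal U$ be the set of measurable $u:[t_0,\infty)\to U$, and let $y(\cdot,y_0,u)$ be the absolutely continuous solution of $\dot y=A(t)y+B(t)u(t)$ a.e., $y(t_0)=y_0$. Put $$T(y_0)=\inf_{u\in\mathcal U}\inf\{t\ge t_0: y(t,y_0,u)\in S\}\in[t_0,\infty],\quad \mathcal R(t)=\{y_0: \exists u\in\mathcal U,\ y(t,y_0,u)\in S\},\quad \mathcal R=\bigcup_{t\ge t_0}\mathcal R(t),$$ and assume that $\mathcal R(t_1)\subset\operatorname{int}\mathcal R(t_2)$ whenever $t_0\le t_1<t_2\le t_f$. **Discrete reachable sets.** Let $K,N\ge1$ be integers, $\Delta t=(t_f-t_0)/K$, $h=\Delta t/N$, $t_i=t_0+i\Delta t$, $t_{ij}=t_i+jh$, and $\bar B(t)=-B(t_0+t_f-t)$. Let $c_0,\dots,c_N\ge0$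 be weights, and let $\Phi_h(t,s)\in\mathbb R^{n\times n}$ be given for $t,s$ in the grid $t_0+h\{0,\dots,KN\}$, with $\Phi_h(t,t_0)=\Phi_h(t,s)\Phi_h(s,t_0)$ for $s\le t$. Let $l^1,\dots,l^{N_{\mathcal R}}\in\mathbb R^n$ and $\eta^1,\dots,\eta^{N_U}\in\mathbb R^m$ be unit vectors. For a set $M$ let $y(l,M)$ denote an arbitrarily chosen maximizer of $\langle l,\cdot\rangle$ over $M$. Set $\widetilde U_\Delta=\{y(\eta^r,U)\}_r$, $Y_{h\Delta}(t_0)=\{y(l^k,S)\}_k$ and, for $i=0,\dots,K-1$, $$\widetilde{\mathcal R}_{h\Delta}(t_{i+1})=\operatorname{co}\Big(\Phi_h(t_{i+1},t_i)Y_{h\Delta}(t_i)+h\sum_{j=0}^N c_j\Phi_h(t_{i+1},t_{ij})\bar B(t_{ij})\widetilde U_\Delta\Big),\quad Y_{h\Delta}(t_{i+1})=\{y(l^k,\widetilde{\mathcal R}_{h\Delta}(t_{i+1}))\}_k .$$ Let $\mathcal R_{h\Delta}(t_i)=\operatorname{co}Y_{h\Delta}(t_i)$ for $i=0,\dots,K$,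 $S_\Delta=\mathcal R_{h\Delta}(t_0)$ and $\Omega=\bigcup_{i=0}^K\mathcal R_{h\Delta}(t_i)$. **Discrete minimum time function.** Let $\Gamma_1,\dots,\Gamma_M$ be $n$-simplices with $\Omega\setminus\operatorname{int}S\subset\bigcup_j\Gamma_j\subset\Omega$, any two different ones being disjoint or meeting in a common face, such that all vertices lie in $\bigcup_iY_{h\Delta}(t_i)$, each point of $\bigcup_iY_{h\Delta}(t_i)$ is a vertex of some $\Gamma_j$, and for each $j$ there is $i<K$ such that every vertex of $\Gamma_j$ lies in $\mathcal R_{h\Delta}(t_i)\cup\mathcal R_{h\Delta}(t_{i+1})$. Let $\Delta_\Gamma=\max_j\operatorname{diam}\Gamma_j$. Let $T_{h\Delta}$ be the function on $\Omega$ with $T_{h\Delta}=t_0$ on $S_\Delta$; $T_{h\Delta}(x)=t_i$ for $x\in\partial\mathcal R_{h\Delta}(t_i)\setminus S_\Delta$, $i=1,\dots,K$ (for one such $i$, if there are several); $T_{h\Delta}(x)=\sum_{\nu}\lambda_\nu T_{h\Delta}(x_\nu)$ at all other points $x=\sum_\nu\lambda_\nu x_\nu$ (with $\lambda_\nu\ge0$,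 $\sum_\nu\lambda_\nu=1$) of a simplex with vertices $x_1,\dots,x_{n+1}$; and $T_{h\Delta}=t_0$ at the remaining points of $\Omega$ (which lie in $\operatorname{int}S$). **Theorem 3.4.** Let $\omega:[0,\infty)\to\mathbb R$ be non-decreasing with $|T(x)-T(y)|\le\omega(\|x-y\|)$ for all $x,y\in\mathcal R$. Suppose that $\Omega\subset\mathcal R$ (so that $T$ is finite on $\Omega$) and that, for some real $C$ and $p$, $d_H(\mathcal R_{h\Delta}(t_i),\mathcal R(t_i))\le Ch^p$ for $i=0,\dots,K$, where $d_H$ is the Hausdorff distance. Then $$\|T-T_{h\Delta}\|_{\infty,\Omega}=\sup_{x\in\Omega}|T(x)-T_{h\Delta}(x)|\le\omega(\Delta_\Gamma)+\omega(Ch^p).$$ -/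

import Mathlib

open MeasureTheory Set
open scoped Pointwise ENNReal

/-- `ℝⁿ` with the Euclidean norm. -/
abbrev RSpace (n : ℕ) : Type := EuclideanSpace ℝ (Fin n)

/-- The data of the linear minimum time problem
`ẏ(t) = A(t) y(t) + B(t) u(t)`, `u(t) ∈ U`, with target set `S`, initial time `t₀` and maximal
time `tf`. The matrices `A(t) ∈ ℝⁿˣⁿ`, `B(t) ∈ ℝⁿˣᵐ` are given as linear maps. -/
structure ControlProblem (n m : ℕ) where
  A : ℝ → (RSpace n →L[ℝ] RSpace n)
  B : ℝ → (RSpace m →L[ℝ] RSpace n)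
  U : Set (RSpace m)
  S : Set (RSpace n)
  t₀ : ℝ
  tf : ℝ

namespace ControlProblem

variable {n m : ℕ} (P : ControlProblem n m)

/-- Admissible controls: measurable functions `[t₀, ∞) → U`. -/
def admissible : Set (ℝ → RSpace m) :=
  {u | Measurable u ∧ ∀ t, P.t₀ ≤ t → u t ∈ P.U}

/-- `y` is the (absolutely continuous) solution on `[t₀, t]` of `ẏ = A y + B u` a.e. with
`y(t₀) = y₀`, written as a Carathéodory solution of the integral equation. -/
def IsSolution (y₀ : RSpace n) (u : ℝ → RSpace m) (t : ℝ) (y : ℝ → RSpace n) : Prop :=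
  ContinuousOn y (Icc P.t₀ t) ∧
    ∀ s ∈ Icc P.t₀ t, y s = y₀ + ∫ r in P.t₀..s, (P.A r (y r) + P.B r (u r))

/-- `y(t, y₀, u) ∈ S`: the trajectory starting at `y₀` with control `u` is in the target at
time `t`. -/
def InTargetAt (y₀ : RSpace n) (u : ℝ → RSpace m) (t : ℝ) : Prop :=
  ∃ y : ℝ → RSpace n, P.IsSolution y₀ u t y ∧ y t ∈ P.S

/-- `t(y₀, u)`, the first time at which the trajectory hits the target (`⊤` if it never does). -/
noncomputable def hittingTime (y₀ : RSpace n) (u : ℝ → RSpace m) : EReal :=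
  sInf ((fun t : ℝ => (t : EReal)) '' {t | P.t₀ ≤ t ∧ P.InTargetAt y₀ u t})

/-- The minimum time function `T`, with values in `[t₀, ∞]`. -/
noncomputable def minTime (y₀ : RSpace n) : EReal :=
  ⨅ u ∈ P.admissible, P.hittingTime y₀ u

/-- The reachable set `R(t)` for fixed end time `t`. -/
def reach (t : ℝ) : Set (RSpace n) :=
  {y₀ | ∃ u ∈ P.admissible, P.InTargetAt y₀ u t}

/-- The reachable set `R` up to a finite time. -/
def reachAll : Set (RSpace n) := ⋃ t ∈ Ici P.t₀, P.reach t

/-- The standing assumptions (i)-(iv). -/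
structure StandingAssumptions : Prop where
  t₀_lt_tf : P.t₀ < P.tf
  integrable_A : ∀ t, P.t₀ ≤ t → IntegrableOn P.A (Icc P.t₀ t)
  integrable_B : ∀ t, P.t₀ ≤ t → IntegrableOn P.B (Icc P.t₀ t)
  convex_U : Convex ℝ P.U
  isCompact_U : IsCompact P.U
  nonempty_U : P.U.Nonempty
  convex_S : Convex ℝ P.S
  isCompact_S : IsCompact P.S
  nonempty_S : P.S.Nonempty
  strictly_expanding : ∀ t₁ t₂, P.t₀ ≤ t₁ → t₁ < t₂ → t₂ ≤ P.tf →
    P.reach t₁ ⊆ interior (P.reach t₂)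

/-- The matrix `B̄(t) = -B(t₀ + tf - t)` of the time-reversed system. -/
def Bbar (t : ℝ) : RSpace m →L[ℝ] RSpace n := -P.B (P.t₀ + P.tf - t)

end ControlProblem

/-- The supporting face `Y(l, A)` of `A` in direction `l`. -/
def supportingFace {n : ℕ} (l : RSpace n) (A : Set (RSpace n)) : Set (RSpace n) :=
  {x | x ∈ A ∧ ∀ z ∈ A, inner ℝ l z ≤ inner ℝ l x}

/-- The parameters of a set-valued combination method with discretized directions:
`K` coarse time intervals, each divided into `N` steps; `Φ k l` stands for `Φ_h(t₀ + k h, t₀ + l h)`,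
the approximate fundamental solution on the fine grid, with its semigroup property;
the quadrature weights `c j ≥ 0`, `j = 0, …, N`; finitely many normed directions in `ℝⁿ`, `ℝᵐ`. -/
structure DiscreteScheme (n m : ℕ) where
  K : ℕ
  N : ℕ
  K_pos : 0 < K
  N_pos : 0 < N
  Φ : ℕ → ℕ → (RSpace n →L[ℝ] RSpace n)
  Φ_semigroup : ∀ k l, k + l ≤ K * N → Φ (k + l) 0 = (Φ (k + l) k).comp (Φ k 0)
  c : ℕ → ℝ
  c_nonneg : ∀ j ≤ N, 0 ≤ c j
  numDirR : ℕ
  dirR : Fin numDirR → RSpace n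
  norm_dirR : ∀ k, ‖dirR k‖ = 1
  numDirU : ℕ
  dirU : Fin numDirU → RSpace m
  norm_dirU : ∀ r, ‖dirU r‖ = 1

namespace DiscreteScheme

variable {n m : ℕ} (D : DiscreteScheme n m) (P : ControlProblem n m)

/-- `Δt = (tf - t₀) / K`. -/
noncomputable def dt : ℝ := (P.tf - P.t₀) / D.K

/-- The step size `h = Δt / N`. -/
noncomputable def h : ℝ := D.dt P / D.N

/-- `tᵢ = t₀ + i Δt`. -/
noncomputable def time (i : ℕ) : ℝ := P.t₀ + i * D.dt P

/-- `tᵢⱼ = tᵢ + j h`. -/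
noncomputable def subTime (i j : ℕ) : ℝ := D.time P i + j * D.h P

/-- One step of the scheme, applied to the point sets `Y` (for `Y_{hΔ}(tᵢ)`) and `V` (for `Ũ_Δ`):
`Φ_h(tᵢ₊₁, tᵢ) Y + h ∑_{j=0}^N c_j Φ_h(tᵢ₊₁, tᵢⱼ) B̄(tᵢⱼ) V` (Minkowski sums). -/
noncomputable def step (i : ℕ) (Y : Set (RSpace n)) (V : Set (RSpace m)) : Set (RSpace n) :=
  D.Φ ((i + 1) * D.N) (i * D.N) '' Y +
    D.h P • ∑ j ∈ Finset.range (D.N + 1),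
      D.c j • ((D.Φ ((i + 1) * D.N) (i * D.N + j)).comp (P.Bbar (D.subTime P i j)) '' V)

end DiscreteScheme

/-- A run of the algorithm that computes the supporting points of the fully discrete reachable
sets. The supporting point in each direction is an arbitrary element of the supporting face:
`u r = y(ηʳ, U)`, `y 0 k = y(lᵏ, S)`, `y (i+1) k = y(lᵏ, R̃_{hΔ}(tᵢ₊₁))`. -/
structure AlgorithmRun {n m : ℕ} (P : ControlProblem n m) (D : DiscreteScheme n m) where
  u : Fin D.numDirU → RSpace m
  u_mem : ∀ r, u r ∈ supportingFace (D.dirU r) P.U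
  y : ℕ → Fin D.numDirR → RSpace n
  y_zero : ∀ k, y 0 k ∈ supportingFace (D.dirR k) P.S
  y_succ : ∀ i < D.K, ∀ k, y (i + 1) k ∈
    supportingFace (D.dirR k) (convexHull ℝ (D.step P i (range (y i)) (range u)))

namespace AlgorithmRun

variable {n m : ℕ} {P : ControlProblem n m} {D : DiscreteScheme n m} (Z : AlgorithmRun P D)

/-- `Y_{hΔ}(tᵢ)`. -/
def Y (i : ℕ) : Set (RSpace n) := range (Z.y i)

/-- The fully discrete reachable set `R_{hΔ}(tᵢ) = co Y_{hΔ}(tᵢ)`; for `i = 0` it is `S_Δ`. -/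
def R (i : ℕ) : Set (RSpace n) := convexHull ℝ (Z.Y i)

/-- The computational domain `Ω`, the union of `R_{hΔ}(tᵢ)`, `i = 0, …, K`. -/
def Ω : Set (RSpace n) := ⋃ i ∈ Iic D.K, Z.R i

end AlgorithmRun

/-- A simplicial triangulation over `Ω \ int S` with grid nodes in the sets `Y_{hΔ}(tᵢ)`.
As the nodes closest to the target lie in `S_Δ ⊆ S`, a curved boundary of `S` cannot be met
exactly; the covering condition admits a triangulation of `Ω \ int S`, one of `Ω \ int S_Δ`,
and everything in between. -/
structure Triangulation {n m : ℕ} {P : ControlProblem n m} {D : DiscreteScheme n m}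
    (Z : AlgorithmRun P D) where
  M : ℕ
  simplex : Fin M → Affine.Simplex ℝ (RSpace n) n
  /-- the simplices cover the domain outside the interior of the target -/
  covers : Z.Ω \ interior P.S ⊆ ⋃ j, convexHull ℝ (range (simplex j).points)
  subset_domain : (⋃ j, convexHull ℝ (range (simplex j).points)) ⊆ Z.Ω
  /-- two different simplices meet in a common face, or not at all -/
  inter_face : ∀ j j', j ≠ j' →
    convexHull ℝ (range (simplex j).points) ∩ convexHull ℝ (range (simplex j').points) =
      convexHull ℝ (range (simplex j).points ∩ range (simplex j').points)
  /-- the grid nodes are supporting points -/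
  nodes : ∀ j ν, ∃ i ≤ D.K, (simplex j).points ν ∈ Z.Y i
  /-- every supporting point is a vertex of some simplex -/
  supporting_points : ∀ i ≤ D.K, ∀ x ∈ Z.Y i, ∃ j ν, (simplex j).points ν = x
  /-- the vertices of a simplex belong to two consecutive discrete reachable sets -/
  layers : ∀ j, ∃ i < D.K, ∀ ν, (simplex j).points ν ∈ Z.R i ∪ Z.R (i + 1)

namespace Triangulation

variable {n m : ℕ} {P : ControlProblem n m} {D : DiscreteScheme n m} {Z : AlgorithmRun P D}
  (G : Triangulation Z)

/-- The closed simplex `Γⱼ`. -/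
def cell (j : Fin G.M) : Set (RSpace n) := convexHull ℝ (range (G.simplex j).points)

/-- The maximal diameter `Δ_Γ` of the simplices. -/
noncomputable def maxDiam : ℝ := ⨆ j, Metric.diam (G.cell j)

end Triangulation

/-- `x` lies on the boundary of one of the sets `R_{hΔ}(tᵢ)`, `i = 1, …, K`. -/
def AlgorithmRun.OnBoundary {n m : ℕ} {P : ControlProblem n m} {D : DiscreteScheme n m}
    (Z : AlgorithmRun P D) (x : RSpace n) : Prop :=
  ∃ i, 1 ≤ i ∧ i ≤ D.K ∧ x ∈ frontier (Z.R i)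

/-- `T` is the fully discrete minimum time function `T_{hΔ}` on `Ω`: it is `t₀` on `S_Δ`, `tᵢ` on
the boundary of `R_{hΔ}(tᵢ)`, and at all other points it is interpolated linearly on the simplices.
If a point is on the boundary of several `R_{hΔ}(tᵢ)` (impossible when these sets are strictly
nested), any of the times `tᵢ` is allowed. Points of the target that no simplex contains
get the value `t₀`. -/
structure IsDiscreteMinTime {n m : ℕ} {P : ControlProblem n m} {D : DiscreteScheme n m}
    {Z : AlgorithmRun P D} (G : Triangulation Z) (T : RSpace n → ℝ) : Prop where
  on_target : ∀ x ∈ Z.R 0, T x = P.t₀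
  on_boundary : ∀ x ∉ Z.R 0, Z.OnBoundary x →
    ∃ i, 1 ≤ i ∧ i ≤ D.K ∧ x ∈ frontier (Z.R i) ∧ T x = D.time P i
  on_simplex : ∀ x ∈ Z.Ω, x ∉ Z.R 0 → ¬ Z.OnBoundary x →
    ∀ (j : Fin G.M) (w : Fin (n + 1) → ℝ), (∀ ν, 0 ≤ w ν) → ∑ ν, w ν = 1 →
      x = ∑ ν, w ν • (G.simplex j).points ν →
      T x = ∑ ν, w ν * T ((G.simplex j).points ν)
  on_rest : ∀ x ∈ Z.Ω, x ∉ Z.R 0 → ¬ Z.OnBoundary x → x ∈ P.S →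
    (∀ j, x ∉ G.cell j) → T x = P.t₀

/-- The supremum norm of `f` over `Ω`, with values in `[0, ∞]`. -/
noncomputable def supNormOn {n : ℕ} (Ω : Set (RSpace n)) (f : RSpace n → ℝ) : ℝ≥0∞ :=
  ⨆ x ∈ Ω, ‖f x‖ₑ

/-! On the boundary of `R(t)` the minimum time function is exactly `t`: a point reached earlier
would, by strict expansion, be interior. Every boundary point of the convex set `R_{hΔ}(tᵢ)` lies
within `C h^p` of a boundary point of `R(tᵢ)`, so there `T` differs from `tᵢ` by at most
`ω (C h^p)`. The grid nodes are supporting points, hence boundary points, and the values inside a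
simplex are convex combinations of the values at its nodes, each at distance at most `Δ_Γ`.

That boundary points of `R(t)` belong to `R(t)` needs compactness of the reachable sets. Solving
backward from the target, the initial value is a continuous linear function of the end point and of
the control in `L²(‖B(r)‖ dr)`, and the controls with values in `U` form a weakly compact set. The
weight `‖B(r)‖` keeps the control operator bounded although `B` is only integrable. -/

section Convex

theorem notMem_interior_of_isMaxOn {E : Type*} [NormedAddCommGroup E] [NormedSpace ℝ E]
    {A : Set E} {f : StrongDual ℝ E} (hf : f ≠ 0) {x : E} (hx : IsMaxOn f A x) :
    x ∉ interior A := fun hxA =>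
  hf ((hx.isLocalMax (mem_interior_iff_mem_nhds.1 hxA)).hasFDerivAt_eq_zero f.hasFDerivAt)

theorem subset_interior_of_isPreconnected {α : Type*} [TopologicalSpace α] {s t : Set α}
    (hs : IsPreconnected s) (hst : (s ∩ t).Nonempty) (hdisj : Disjoint s (frontier t)) :
    s ⊆ interior t := by
  have hcover : s ⊆ interior t ∪ (closure t)ᶜ := fun x hx =>
    or_iff_not_imp_left.2 fun hint hcl => hdisj.notMem_of_mem_left hx ⟨hcl, hint⟩
  refine hs.subset_left_of_subset_union isOpen_interior isClosed_closure.isOpen_compl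
    (disjoint_compl_right_iff_subset.2 interior_subset_closure) hcover ?_
  obtain ⟨x, hxs, hxt⟩ := hst
  exact ⟨x, hxs, (hcover hxs).resolve_right fun h => h (subset_closure hxt)⟩

/-- `p` is obtained by moving from `q` away from its projection onto `A`. -/
theorem exists_dist_le_lt_infDist_of_convex {E : Type*} [NormedAddCommGroup E]
    [InnerProductSpace ℝ E] [CompleteSpace E] {A : Set E} (hA : Convex ℝ A) (hAc : IsClosed A)
    (hne : A.Nonempty) {q : E} (hq : q ∉ A) {d : ℝ} (hd : 0 ≤ d) :
    ∃ p, dist p q ≤ d ∧ d < Metric.infDist p A := by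
  obtain ⟨v, hv, hqv⟩ := exists_norm_eq_iInf_of_complete_convex hne hAc.isComplete hA q
  have hnormal := (norm_eq_iInf_iff_real_inner_le_zero hA hv).1 hqv
  have hr : 0 < ‖q - v‖ := norm_pos_iff.2 (sub_ne_zero.2 fun h => hq (h ▸ hv))
  set e := q - v with he
  set r := ‖e‖
  refine ⟨q + (d / r) • e, ?_, ?_⟩
  · rw [dist_self_add_left, norm_smul, Real.norm_of_nonneg (by positivity),
      div_mul_cancel₀ _ hr.ne']
  refine (lt_add_of_pos_right d hr).trans_le ((Metric.le_infDist hne).2 fun a ha => ?_)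
  rw [dist_eq_norm]
  refine le_of_mul_le_mul_right ?_ hr
  calc (d + r) * r
      ≤ (d + r) * r - inner ℝ e (a - v) := by linarith [hnormal a ha]
    _ = inner ℝ (q + (d / r) • e - a) e := by
        rw [show q + (d / r) • e - a = (1 + d / r) • e - (a - v) by rw [he]; module,
          inner_sub_left (_ • e), real_inner_smul_left, real_inner_self_eq_norm_sq,
          real_inner_comm e]
        field_simp
        ring
    _ ≤ ‖q + (d / r) • e - a‖ * r := real_inner_le_norm _ _

theorem exists_mem_frontier_dist_le_hausdorffDist {E : Type*} [NormedAddCommGroup E]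
    [InnerProductSpace ℝ E] [ProperSpace E] {A B : Set E} (hA : IsCompact A)
    (hAconv : Convex ℝ A) (hB : IsCompact B) (hBne : B.Nonempty) {x : E} (hx : x ∈ frontier A) :
    ∃ z ∈ frontier B, dist x z ≤ Metric.hausdorffDist A B := by
  -- Otherwise the closed ball of radius `d` about `x` lies in the interior of `B`, and moving by
  -- `d` along an outer normal, from a point outside `A` close to `x`, leads to a point of `B` whose
  -- distance from `A` exceeds `d`.
  by_contra! h
  set d := Metric.hausdorffDist A B
  have hd : 0 ≤ d := Metric.hausdorffDist_nonneg
  have hxA : x ∈ A := hA.isClosed.frontier_subset hx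
  have hfin : Metric.hausdorffEDist A B ≠ ⊤ :=
    Metric.hausdorffEDist_ne_top_of_nonempty_of_bounded ⟨x, hxA⟩ hBne hA.isBounded hB.isBounded
  have hball : Metric.closedBall x d ⊆ interior B := by
    obtain ⟨y, hyB, hxy⟩ := hB.exists_infDist_eq_dist hBne x
    have hxyd : dist x y ≤ d := hxy ▸ Metric.infDist_le_hausdorffDist_of_mem hxA hfin
    refine subset_interior_of_isPreconnected Metric.isPreconnected_closedBall
      ⟨y, Metric.mem_closedBall'.2 hxyd, hyB⟩ (disjoint_left.2 fun z hz hzB => ?_)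
    exact (h z hzB).not_ge (Metric.mem_closedBall'.1 hz)
  obtain ⟨δ, hδ, hball⟩ :=
    (isCompact_closedBall x d).exists_cthickening_subset_open isOpen_interior hball
  rw [cthickening_closedBall hδ.le hd] at hball
  have hxc : x ∈ closure Aᶜ := (frontier_eq_closure_inter_closure.subset hx).2
  obtain ⟨q, hqA, hxq⟩ := Metric.mem_closure_iff.1 hxc δ hδ
  obtain ⟨p, hpq, hp⟩ := exists_dist_le_lt_infDist_of_convex hAconv hA.isClosed ⟨x, hxA⟩ hqA hd
  have hpB : p ∈ B := interior_subset (hball (Metric.mem_closedBall.2 (by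
    linarith [dist_triangle p q x, dist_comm x q])))
  refine hp.not_ge ?_
  rw [Metric.hausdorffEDist_comm] at hfin
  exact (Metric.infDist_le_hausdorffDist_of_mem hpB hfin).trans_eq Metric.hausdorffDist_comm

end Convex

section Weak

theorem isCompact_toWeakSpace_image {H : Type*} [NormedAddCommGroup H] [NormedSpace ℝ H]
    (hH : Function.Surjective (NormedSpace.inclusionInDoubleDual ℝ H)) {s : Set H}
    (hs : Convex ℝ s) (hsc : IsClosed s) (hsb : Bornology.IsBounded s) :
    IsCompact (toWeakSpace ℝ H '' s) := by
  rw [← hsc.closure_eq, hs.toWeakSpace_closure ℝ]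
  refine NormedSpace.isCompact_closure_of_isBounded ℝ H _ ?_ fun φ _ => ?_
  · rwa [preimage_image_eq _ (toWeakSpace ℝ H).injective]
  · obtain ⟨x, hx⟩ := hH (WeakDual.toStrongDual φ)
    exact ⟨toWeakSpace ℝ H x, congrArg StrongDual.toWeakDual hx⟩

theorem inclusionInDoubleDual_surjective {H : Type*} [NormedAddCommGroup H]
    [InnerProductSpace ℝ H] [CompleteSpace H] :
    Function.Surjective (NormedSpace.inclusionInDoubleDual ℝ H) := by
  intro φ
  refine ⟨(InnerProductSpace.toDual ℝ H).symm
    (φ.comp (InnerProductSpace.toDual ℝ H).toContinuousLinearEquiv.toContinuousLinearMap), ?_⟩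
  ext f
  obtain ⟨y, rfl⟩ := (InnerProductSpace.toDual ℝ H).surjective f
  rw [NormedSpace.dual_def, InnerProductSpace.toDual_apply_apply, real_inner_comm,
    InnerProductSpace.toDual_symm_apply]
  rfl

theorem isCompact_clm_image {H F : Type*} [NormedAddCommGroup H] [InnerProductSpace ℝ H]
    [CompleteSpace H] [NormedAddCommGroup F] [NormedSpace ℝ F] [FiniteDimensional ℝ F]
    (T : H →L[ℝ] F) {s : Set H} (hs : Convex ℝ s) (hsc : IsClosed s)
    (hsb : Bornology.IsBounded s) : IsCompact (T '' s) := by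
  have : FiniteDimensional ℝ (WeakSpace ℝ F) := .of_surjective _ (toWeakSpace ℝ F).surjective
  have hcont : Continuous (toWeakSpace ℝ F).symm :=
    (toWeakSpace ℝ F).symm.toLinearMap.continuous_of_finiteDimensional
  have himage : T '' s =
      (fun x => (toWeakSpace ℝ F).symm (WeakSpace.map T x)) '' (toWeakSpace ℝ H '' s) := by
    rw [image_image]
    rfl
  rw [himage]
  exact (isCompact_toWeakSpace_image inclusionInDoubleDual_surjective hs hsc hsb).image
    (hcont.comp (WeakSpace.map T).continuous)

end Weak

section Multiplication

variable {α V E : Type*} [MeasurableSpace α] [NormedAddCommGroup V] [NormedSpace ℝ V]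
  [NormedAddCommGroup E] [NormedSpace ℝ E] {ν : Measure α} {B : α → V →L[ℝ] E} {p : ℝ≥0∞}

/-- The measure with density `‖B‖`. Multiplication by `B` is a bounded operator from its `L¹` space
to `L¹(ν)`, even where `B` itself is unbounded. -/
noncomputable def opNormMeasure (ν : Measure α) (B : α → V →L[ℝ] E) : Measure α :=
  ν.withDensity fun r => ‖B r‖ₑ

theorem isFiniteMeasure_opNormMeasure (hB : Integrable B ν) :
    IsFiniteMeasure (opNormMeasure ν B) :=
  isFiniteMeasure_withDensity hB.2.ne

theorem clm_apply_ae_eq (hB : AEStronglyMeasurable B ν) {u v : α → V}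
    (huv : u =ᵐ[opNormMeasure ν B] v) : (fun r => B r (u r)) =ᵐ[ν] fun r => B r (v r) := by
  filter_upwards [(ae_withDensity_iff' hB.enorm).1 huv] with r hr
  rcases eq_or_ne (B r) 0 with h0 | h0
  · simp only [h0, zero_apply]
  · rw [hr (ENNReal.coe_ne_zero.2 (nnnorm_ne_zero_iff.2 h0))]

theorem eLpNorm_clm_apply_le (hB : AEStronglyMeasurable B ν) {u : α → V}
    (hu : StronglyMeasurable u) :
    eLpNorm (fun r => B r (u r)) 1 ν ≤ eLpNorm u 1 (opNormMeasure ν B) := by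
  rw [eLpNorm_one_eq_lintegral_enorm, eLpNorm_one_eq_lintegral_enorm, opNormMeasure,
    lintegral_withDensity_eq_lintegral_mul₀ hB.enorm hu.enorm.aemeasurable]
  exact lintegral_mono fun r => (B r).le_opENorm (u r)

theorem memLp_clm_apply (hB : Integrable B ν) (hp : 1 ≤ p) (u : Lp V p (opNormMeasure ν B)) :
    MemLp (fun r => B r (u r)) 1 ν := by
  have := isFiniteMeasure_opNormMeasure hB
  have hu := Lp.stronglyMeasurable u
  exact ⟨(ContinuousLinearMap.id ℝ (V →L[ℝ] E)).aestronglyMeasurable_comp₂ hB.1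
      hu.aestronglyMeasurable,
    (eLpNorm_clm_apply_le hB.1 hu).trans_lt ((Lp.memLp u).mono_exponent hp).2⟩

/-- Multiplication by `B`, `L^p(‖B‖ ν) → L¹(ν)`. -/
noncomputable def applyL1 (hB : Integrable B ν) [hp : Fact (1 ≤ p)] :
    Lp V p (opNormMeasure ν B) →L[ℝ] Lp E 1 ν :=
  LinearMap.mkContinuous
    { toFun := fun u => (memLp_clm_apply hB hp.out u).toLp _
      map_add' := fun u v => by
        rw [← MemLp.toLp_add, MemLp.toLp_eq_toLp_iff]
        refine (clm_apply_ae_eq hB.1 (Lp.coeFn_add u v)).trans (.of_forall fun r => ?_)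
        exact map_add (B r) _ _
      map_smul' := fun c u => by
        rw [RingHom.id_apply, ← MemLp.toLp_const_smul, MemLp.toLp_eq_toLp_iff]
        refine (clm_apply_ae_eq hB.1 (Lp.coeFn_smul c u)).trans (.of_forall fun r => ?_)
        exact map_smul (B r) _ _ }
    (opNormMeasure ν B univ ^ (1 - 1 / p.toReal)).toReal
    fun u => by
      have := isFiniteMeasure_opNormMeasure hB
      have hle := (eLpNorm_clm_apply_le hB.1 (Lp.stronglyMeasurable u)).trans
        (eLpNorm_le_eLpNorm_mul_rpow_measure_univ hp.out (Lp.aestronglyMeasurable u))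
      rw [LinearMap.coe_mk, AddHom.coe_mk, Lp.norm_toLp, Lp.norm_def, mul_comm,
        ← ENNReal.toReal_mul]
      refine ENNReal.toReal_mono (ENNReal.mul_ne_top (Lp.eLpNorm_ne_top u) ?_) ?_
      · refine ENNReal.rpow_ne_top_of_nonneg ?_ (measure_ne_top _ _)
        rcases ENNReal.dichotomy p with rfl | h1
        · simp
        · exact sub_nonneg.2 (div_le_one_of_le₀ h1 (zero_le_one.trans h1))
      · simpa using hle

theorem coeFn_applyL1 (hB : Integrable B ν) [hp : Fact (1 ≤ p)]
    (u : Lp V p (opNormMeasure ν B)) : applyL1 hB u =ᵐ[ν] fun r => B r (u r) :=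
  (memLp_clm_apply hB hp.out u).coeFn_toLp

end Multiplication

section Primitive
open scoped BoundedContinuousFunction

theorem norm_intervalIntegral_le_integral_norm {E : Type*} [NormedAddCommGroup E]
    [NormedSpace ℝ E] {f : ℝ → E} (hf : Integrable f) (b s : ℝ) :
    ‖∫ r in b..s, f r‖ ≤ ∫ r, ‖f r‖ :=
  intervalIntegral.norm_integral_le_integral_norm_uIoc.trans
    (setIntegral_le_integral hf.norm (.of_forall fun _ => norm_nonneg _))

theorem integral_mul_primitive_pow {f : ℝ → ℝ} (hf : Integrable f) (b s : ℝ) (k : ℕ) :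
    ∫ r in b..s, f r * (∫ q in b..r, f q) ^ k = (∫ q in b..s, f q) ^ (k + 1) / (k + 1) := by
  set F : ℝ → ℝ := fun r => ∫ q in b..r, f q
  have hac : ∀ j, AbsolutelyContinuousOnInterval (fun r => F r ^ (j + 1)) b s := fun j => by
    have hac₁ : AbsolutelyContinuousOnInterval F b s :=
      hf.intervalIntegrable.absolutelyContinuousOnInterval_intervalIntegral left_mem_uIcc
    induction j with
    | zero => simpa using hac₁
    | succ j ih =>
      simp only [pow_succ _ (j + 1)]
      exact ih.mul hac₁
  have hderiv : ∀ᵐ r, deriv (fun r => F r ^ (k + 1)) r = (k + 1) * (f r * F r ^ k) := by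
    filter_upwards [LocallyIntegrable.ae_hasDerivAt_integral hf.locallyIntegrable] with r hr
    rw [((hr b).fun_pow (k + 1)).deriv, Nat.add_sub_cancel, Nat.cast_succ]
    ring
  have hFb : F b = 0 := intervalIntegral.integral_same
  have hFTC := (hac k).integral_deriv_eq_sub
  rw [intervalIntegral.integral_congr_ae (hderiv.mono fun r hr _ => hr),
    intervalIntegral.integral_const_mul, hFb, zero_pow k.succ_ne_zero, sub_zero] at hFTC
  rw [eq_div_iff (by positivity), mul_comm, hFTC]

theorem abs_integral_mul_abs_primitive_pow {f : ℝ → ℝ} (hf : Integrable f) (hf0 : 0 ≤ f)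
    (b s : ℝ) (k : ℕ) :
    |∫ r in b..s, f r * |∫ q in b..r, f q| ^ k| = |∫ q in b..s, f q| ^ (k + 1) / (k + 1) := by
  obtain ⟨ε, hε, hsign⟩ : ∃ ε : ℝ, |ε| = 1 ∧
      ∀ r ∈ uIcc b s, |∫ q in b..r, f q| = ε * ∫ q in b..r, f q := by
    rcases le_total b s with hbs | hsb
    · refine ⟨1, abs_one, fun r hr => ?_⟩
      rw [uIcc_of_le hbs] at hr
      rw [one_mul, abs_of_nonneg (intervalIntegral.integral_nonneg hr.1 fun q _ => hf0 q)]
    · refine ⟨-1, by simp, fun r hr => ?_⟩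
      rw [uIcc_of_ge hsb] at hr
      rw [neg_one_mul, intervalIntegral.integral_symm, abs_neg,
        abs_of_nonneg (intervalIntegral.integral_nonneg hr.2 fun q _ => hf0 q), neg_neg]
  have hcongr : ∀ r ∈ uIcc b s,
      f r * |∫ q in b..r, f q| ^ k = ε ^ k * (f r * (∫ q in b..r, f q) ^ k) := fun r hr => by
    rw [hsign r hr]
    ring
  rw [intervalIntegral.integral_congr hcongr, intervalIntegral.integral_const_mul,
    integral_mul_primitive_pow hf, abs_mul, abs_pow, hε, one_pow, one_mul, abs_div, abs_pow,
    abs_of_pos (by positivity : (0 : ℝ) < k + 1)]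

variable {E : Type*} [NormedAddCommGroup E] [NormedSpace ℝ E]

/-- The primitive `s ↦ ∫ r in b..s, f r` of an integrable function, as an operator
`L¹(ℝ) → C_b(ℝ)`. -/
noncomputable def primitive (b : ℝ) : Lp E 1 (volume : Measure ℝ) →L[ℝ] (ℝ →ᵇ E) :=
  LinearMap.mkContinuous
    { toFun := fun f => .ofNormedAddCommGroup (fun s => ∫ r in b..s, f r)
        (intervalIntegral.continuous_primitive
          (fun _ _ => (L1.integrable_coeFn f).intervalIntegrable) b)
        _ (norm_intervalIntegral_le_integral_norm (L1.integrable_coeFn f) b)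
      map_add' := fun f g => by
        ext s
        refine (intervalIntegral.integral_congr_ae
          ((Lp.coeFn_add f g).mono fun r hr _ => hr)).trans ?_
        exact intervalIntegral.integral_add (L1.integrable_coeFn f).intervalIntegrable
          (L1.integrable_coeFn g).intervalIntegrable
      map_smul' := fun c f => by
        ext s
        refine (intervalIntegral.integral_congr_ae
          ((Lp.coeFn_smul c f).mono fun r hr _ => hr)).trans ?_
        exact intervalIntegral.integral_smul c _ }
    1
    fun f => by
      rw [one_mul, L1.norm_eq_integral_norm]
      exact BoundedContinuousFunction.norm_ofNormedAddCommGroup_le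
        _ (by positivity)
        (norm_intervalIntegral_le_integral_norm (L1.integrable_coeFn f) b)

theorem primitive_apply {f : ℝ → E} {F : Lp E 1 (volume : Measure ℝ)} (hF : F =ᵐ[volume] f)
    (b s : ℝ) : primitive b F s = ∫ r in b..s, f r :=
  intervalIntegral.integral_congr_ae (hF.mono fun _ hr _ => hr)

end Primitive

section Volterra
open scoped BoundedContinuousFunction Nat

variable {E : Type*} [NormedAddCommGroup E] [NormedSpace ℝ E] {A : ℝ → E →L[ℝ] E}

/-- The Volterra operator `y ↦ (s ↦ ∫ r in b..s, A r (y r))` on bounded continuous functions. -/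
noncomputable def volterra (b : ℝ) (hA : Integrable A) : (ℝ →ᵇ E) →L[ℝ] (ℝ →ᵇ E) :=
  have := isFiniteMeasure_opNormMeasure hA
  primitive b ∘L applyL1 hA ∘L BoundedContinuousFunction.toLp 1 (opNormMeasure volume A) ℝ

theorem volterra_apply (b : ℝ) (hA : Integrable A) (y : ℝ →ᵇ E) (s : ℝ) :
    volterra b hA y s = ∫ r in b..s, A r (y r) := by
  have := isFiniteMeasure_opNormMeasure hA
  exact primitive_apply ((coeFn_applyL1 hA _).trans
    (clm_apply_ae_eq hA.1 (BoundedContinuousFunction.coeFn_toLp 1 _ ℝ y))) b s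

theorem norm_volterra_pow_apply_le (b : ℝ) (hA : Integrable A) (k : ℕ) (y : ℝ →ᵇ E) (s : ℝ) :
    ‖(volterra b hA ^ k) y s‖ ≤ |∫ r in b..s, ‖A r‖| ^ k / k ! * ‖y‖ := by
  induction k generalizing s with
  | zero => simpa using y.norm_coe_le_norm s
  | succ k ih =>
    rw [pow_succ', mul_apply_eq_comp, volterra_apply]
    have hbound : ∀ r, ‖A r ((volterra b hA ^ k) y r)‖ ≤
        ‖A r‖ * |∫ q in b..r, ‖A q‖| ^ k * (‖y‖ / k !) := fun r =>
      ((A r).le_opNorm_of_le (ih r)).trans_eq (by ring)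
    have hint : IntervalIntegrable (fun r => ‖A r‖ * |∫ q in b..r, ‖A q‖| ^ k * (‖y‖ / k !))
        volume b s := by
      refine (hA.norm.intervalIntegrable.mul_continuousOn ?_).mul_const _
      exact ((intervalIntegral.continuous_primitive
        (fun _ _ => hA.norm.intervalIntegrable) b).abs.pow k).continuousOn
    refine (intervalIntegral.norm_integral_le_abs_of_norm_le (.of_forall hbound) hint).trans_eq ?_
    rw [intervalIntegral.integral_mul_const, abs_mul,
      abs_integral_mul_abs_primitive_pow hA.norm (fun _ => norm_nonneg _),
      abs_of_nonneg (by positivity : (0 : ℝ) ≤ ‖y‖ / k !), Nat.factorial_succ]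
    push_cast
    field_simp

theorem isUnit_one_sub_volterra [CompleteSpace E] (b : ℝ) (hA : Integrable A) :
    IsUnit (1 - volterra b hA : (ℝ →ᵇ E) →L[ℝ] (ℝ →ᵇ E)) := by
  set V := volterra b hA
  set L := ∫ r, ‖A r‖
  obtain ⟨k, hk⟩ := ((FloorSemiring.tendsto_pow_div_factorial_atTop L).eventually
    (eventually_lt_nhds one_pos)).exists
  have hpow : ‖V ^ k‖ < 1 := by
    have : 0 ≤ L := by positivity
    refine lt_of_le_of_lt (ContinuousLinearMap.opNorm_le_bound _ (by positivity) fun y => ?_) hk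
    refine (BoundedContinuousFunction.norm_le (by positivity)).2 fun s => ?_
    refine (norm_volterra_pow_apply_le b hA k y s).trans ?_
    gcongr
    simpa using norm_intervalIntegral_le_integral_norm hA.norm b s
  by_contra hV
  have h1 : (1 : ℝ) ∈ spectrum ℝ V := by
    rwa [spectrum.mem_iff, map_one]
  have h2 := spectrum.pow_mem_pow V k h1
  rw [one_pow, spectrum.mem_iff, map_one] at h2
  exact h2 (isUnit_one_sub_of_norm_lt_one hpow)

end Volterra

section BoundedContinuous
open scoped BoundedContinuousFunction

variable {E : Type*} [NormedAddCommGroup E]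

theorem continuous_bcf_const : Continuous (BoundedContinuousFunction.const ℝ : E → ℝ →ᵇ E) :=
  (LipschitzWith.of_dist_le' (K := 1) fun x y => by
    rw [one_mul]
    exact (BoundedContinuousFunction.dist_le dist_nonneg).2 fun _ => le_rfl).continuous

theorem exists_bcf_eqOn_Icc {f : ℝ → E} {a b : ℝ} (hf : ContinuousOn f (Icc a b)) (hab : a ≤ b) :
    ∃ g : ℝ →ᵇ E, EqOn g f (Icc a b) := by
  let f' : Icc a b →ᵇ E := .mkOfCompact ⟨_, hf.domRestrict⟩
  exact ⟨f'.compContinuous ⟨projIcc a b hab, continuous_projIcc⟩, fun s hs =>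
    congrArg f (congrArg Subtype.val (projIcc_of_mem hab hs))⟩

end BoundedContinuous

section LinearEquation
open scoped BoundedContinuousFunction

variable {E : Type*} [NormedAddCommGroup E] [NormedSpace ℝ E] {A : ℝ → E →L[ℝ] E}

theorem integrable_clm_apply (hA : Integrable A) (y : ℝ →ᵇ E) :
    Integrable fun r => A r (y r) := by
  refine (hA.norm.mul_const ‖y‖).mono' ?_ (.of_forall fun r => ?_)
  · exact (ContinuousLinearMap.id ℝ (E →L[ℝ] E)).aestronglyMeasurable_comp₂ hA.1
      y.continuous.aestronglyMeasurable
  · exact (A r).le_opNorm_of_le (y.norm_coe_le_norm r)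

theorem eq_add_integral_change_base {f y : ℝ → E} (hf : Integrable f) {a b : ℝ} {x z : E} :
    (∀ s, y s = x + ∫ r in a..s, f r) ∧ y b = z ↔ (∀ s, y s = z + ∫ r in b..s, f r) ∧ y a = x := by
  have key : ∀ {a b : ℝ} {x z : E}, (∀ s, y s = x + ∫ r in a..s, f r) ∧ y b = z →
      (∀ s, y s = z + ∫ r in b..s, f r) ∧ y a = x := by
    rintro a b x z ⟨hy, rfl⟩
    refine ⟨fun s => ?_, by simpa using hy a⟩
    rw [hy s, hy b, add_assoc, intervalIntegral.integral_add_adjacent_intervals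
      hf.intervalIntegrable hf.intervalIntegrable]
  exact ⟨key, key⟩

theorem eq_inverse_one_sub_volterra_iff [CompleteSpace E] {b : ℝ} (hA : Integrable A)
    {y f : ℝ →ᵇ E} :
    y = Ring.inverse (1 - volterra b hA : (ℝ →ᵇ E) →L[ℝ] (ℝ →ᵇ E)) f ↔
      ∀ s, y s = f s + ∫ r in b..s, A r (y r) := by
  set V : (ℝ →ᵇ E) →L[ℝ] (ℝ →ᵇ E) := volterra b hA
  have hu : IsUnit (1 - V) := isUnit_one_sub_volterra b hA
  have hiff : y = Ring.inverse (1 - V) f ↔ (1 - V) y = f := by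
    constructor
    · rintro rfl
      rw [← mul_apply_eq_comp, Ring.mul_inverse_cancel _ hu, one_apply_eq_self]
    · rintro rfl
      rw [← mul_apply_eq_comp, Ring.inverse_mul_cancel _ hu, one_apply_eq_self]
  rw [hiff, BoundedContinuousFunction.ext_iff]
  refine forall_congr' fun s => ?_
  rw [← volterra_apply b hA, ← sub_eq_iff_eq_add]
  rfl

/-- The solutions of `ẏ = A y + g` through `x` at time `a` and `z` at time `b` are found by solving
the Volterra equation backward from `b`. -/
theorem exists_solution_iff [CompleteSpace E] (hA : Integrable A) (g : Lp E 1 (volume : Measure ℝ))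
    (a b : ℝ) (x z : E) :
    (∃ y : ℝ →ᵇ E, (∀ s, y s = x + ∫ r in a..s, (A r (y r) + g r)) ∧ y b = z) ↔
      Ring.inverse (1 - volterra b hA : (ℝ →ᵇ E) →L[ℝ] (ℝ →ᵇ E))
        (.const ℝ z + primitive b g) a = x := by
  have hg : Integrable g := L1.integrable_coeFn g
  have hsplit : ∀ (y : ℝ →ᵇ E) s, z + ∫ r in b..s, (A r (y r) + g r) =
      (.const ℝ z + primitive b g : ℝ →ᵇ E) s + ∫ r in b..s, A r (y r) := fun y s => by
    rw [intervalIntegral.integral_add (integrable_clm_apply hA y).intervalIntegrable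
      hg.intervalIntegrable, BoundedContinuousFunction.add_apply,
      BoundedContinuousFunction.const_apply, primitive_apply .rfl]
    abel
  have hbase : ∀ y : ℝ →ᵇ E, (∀ s, y s = x + ∫ r in a..s, (A r (y r) + g r)) ∧ y b = z ↔
      (∀ s, y s = z + ∫ r in b..s, (A r (y r) + g r)) ∧ y a = x := fun y =>
    eq_add_integral_change_base ((integrable_clm_apply hA y).add hg)
  simp only [hbase, hsplit, ← eq_inverse_one_sub_volterra_iff hA, exists_eq_left]

end LinearEquation

section Controls
variable {α V : Type*} [MeasurableSpace α] {μ : Measure α} [NormedAddCommGroup V]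
  {p : ℝ≥0∞} {U : Set V}

/-- The `L^p` functions with values in `U`. -/
def lpWithValuesIn (μ : Measure α) (p : ℝ≥0∞) (U : Set V) : Set (Lp V p μ) :=
  {u | ∀ᵐ r ∂μ, u r ∈ U}

theorem convex_lpWithValuesIn [NormedSpace ℝ V] (hU : Convex ℝ U) :
    Convex ℝ (lpWithValuesIn μ p U) := by
  intro u hu v hv a b ha hb hab
  filter_upwards [hu, hv, Lp.coeFn_add (a • u) (b • v), Lp.coeFn_smul a u, Lp.coeFn_smul b v]
    with r h1 h2 h3 h4 h5
  rw [h3, Pi.add_apply, h4, h5]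
  exact hU h1 h2 ha hb hab

variable [Fact (1 ≤ p)]

theorem isClosed_lpWithValuesIn (hU : IsClosed U) : IsClosed (lpWithValuesIn μ p U) := by
  refine IsSeqClosed.isClosed fun x u hx hu => ?_
  obtain ⟨φ, -, hφ⟩ := (tendstoInMeasure_of_tendsto_Lp hu).exists_seq_tendsto_ae
  filter_upwards [hφ, ae_all_iff.2 fun k => hx (φ k)] with r hr hr'
  exact hU.mem_of_tendsto hr (Filter.Eventually.of_forall hr')

theorem isBounded_lpWithValuesIn [IsFiniteMeasure μ] (hU : Bornology.IsBounded U) :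
    Bornology.IsBounded (lpWithValuesIn μ p U) := by
  obtain ⟨R, hR, hUR⟩ := hU.exists_pos_norm_le
  refine isBounded_iff_forall_norm_le.2 ⟨_, fun u hu => Lp.norm_le_of_ae_bound hR.le ?_⟩
  filter_upwards [hu] with r hr using hUR _ hr

end Controls

namespace ControlProblem
open scoped BoundedContinuousFunction

variable {n m : ℕ} (P : ControlProblem n m)

/-- The coefficient `A` cut off to `[t₀, t]`, which makes it integrable on all of `ℝ`. -/
noncomputable def truncA (t : ℝ) : ℝ → RSpace n →L[ℝ] RSpace n := (Icc P.t₀ t).indicator P.A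

/-- The coefficient `B` cut off to `[t₀, t]`. -/
noncomputable def truncB (t : ℝ) : ℝ → RSpace m →L[ℝ] RSpace n := (Icc P.t₀ t).indicator P.B

/-- The measure `‖B(r)‖ dr` on `[t₀, t]`, against which controls are considered. -/
noncomputable abbrev controlMeasure (t : ℝ) : Measure ℝ := opNormMeasure volume (P.truncB t)

variable {P} {t : ℝ}

theorem integrable_truncA (hP : P.StandingAssumptions) (ht : P.t₀ ≤ t) :
    Integrable (P.truncA t) :=
  IntegrableOn.integrable_indicator (ε' := RSpace n →L[ℝ] RSpace n) (hP.integrable_A t ht)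
    measurableSet_Icc

theorem integrable_truncB (hP : P.StandingAssumptions) (ht : P.t₀ ≤ t) :
    Integrable (P.truncB t) :=
  IntegrableOn.integrable_indicator (ε' := RSpace m →L[ℝ] RSpace n) (hP.integrable_B t ht)
    measurableSet_Icc

theorem ae_controlMeasure_mem_Icc (hP : P.StandingAssumptions) (ht : P.t₀ ≤ t) :
    ∀ᵐ r ∂P.controlMeasure t, r ∈ Icc P.t₀ t := by
  refine (ae_withDensity_iff' (integrable_truncB hP ht).1.enorm).2 (.of_forall fun r hr => ?_)
  by_contra hrt
  exact hr (ENNReal.coe_eq_zero.2 (nnnorm_eq_zero.2 (indicator_of_notMem hrt _)))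

theorem exists_lp_of_mem_admissible (hP : P.StandingAssumptions) (ht : P.t₀ ≤ t)
    {u : ℝ → RSpace m} (hu : u ∈ P.admissible) :
    ∃ w ∈ lpWithValuesIn (P.controlMeasure t) 2 P.U, w =ᵐ[P.controlMeasure t] u := by
  have := isFiniteMeasure_opNormMeasure (integrable_truncB hP ht)
  obtain ⟨R, hR⟩ := hP.isCompact_U.isBounded.exists_norm_le
  have hU : ∀ᵐ r ∂P.controlMeasure t, u r ∈ P.U :=
    (ae_controlMeasure_mem_Icc hP ht).mono fun r hr => hu.2 r hr.1
  have hmem : MemLp u 2 (P.controlMeasure t) :=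
    .of_bound hu.1.aestronglyMeasurable R (hU.mono fun r hr => hR _ hr)
  refine ⟨hmem.toLp u, ?_, hmem.coeFn_toLp⟩
  filter_upwards [hmem.coeFn_toLp, hU] with r hr hrU
  rwa [hr]

theorem exists_mem_admissible_of_lp (hP : P.StandingAssumptions)
    {w : Lp (RSpace m) 2 (P.controlMeasure t)}
    (hw : w ∈ lpWithValuesIn (P.controlMeasure t) 2 P.U) :
    ∃ u ∈ P.admissible, w =ᵐ[P.controlMeasure t] u := by
  classical
  obtain ⟨u₀, hu₀⟩ := hP.nonempty_U
  have hwm : Measurable w := (Lp.stronglyMeasurable w).measurable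
  refine ⟨fun r => if w r ∈ P.U then w r else u₀, ⟨?_, fun r _ => ?_⟩, ?_⟩
  · exact Measurable.ite (hwm hP.isCompact_U.measurableSet) hwm measurable_const
  · beta_reduce
    split_ifs with h
    exacts [h, hu₀]
  · filter_upwards [hw] with r hr using (if_pos hr).symm

theorem integral_trunc (y : ℝ → RSpace n) (u : ℝ → RSpace m) {s : ℝ} (hs : s ∈ Icc P.t₀ t) :
    ∫ r in P.t₀..s, (P.truncA t r (y r) + P.truncB t r (u r)) =
      ∫ r in P.t₀..s, (P.A r (y r) + P.B r (u r)) :=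
  intervalIntegral.integral_congr fun r hr => by
    simp only [truncA, truncB,
      indicator_of_mem (uIcc_subset_Icc (left_mem_Icc.2 (hs.1.trans hs.2)) hs hr)]

theorem IsSolution.exists_bcf (ht : P.t₀ ≤ t) (hA : Integrable (P.truncA t))
    {u : ℝ → RSpace m} (hg : Integrable fun r => P.truncB t r (u r)) {x : RSpace n}
    {y : ℝ → RSpace n} (hy : P.IsSolution x u t y) :
    ∃ Y : ℝ →ᵇ RSpace n, EqOn Y y (Icc P.t₀ t) ∧
      ∀ s, Y s = x + ∫ r in P.t₀..s, (P.truncA t r (Y r) + P.truncB t r (u r)) := by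
  obtain ⟨y', hy'⟩ := exists_bcf_eqOn_Icc hy.1 ht
  have hF := (integrable_clm_apply hA y').add hg
  let Y : ℝ →ᵇ RSpace n := .const ℝ x + primitive P.t₀ (hF.toL1 _)
  have hY : ∀ s, Y s = x + ∫ r in P.t₀..s, (P.truncA t r (y' r) + P.truncB t r (u r)) :=
    fun s => congrArg (x + ·) (primitive_apply hF.coeFn_toL1 _ s)
  have hYy' : EqOn Y y' (Icc P.t₀ t) := fun s hs => by
    rw [hY, integral_trunc _ _ hs, hy' hs, hy.2 s hs]
    congr 1
    refine intervalIntegral.integral_congr fun r hr => ?_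
    simp only [hy' (uIcc_subset_Icc (left_mem_Icc.2 ht) hs hr)]
  refine ⟨Y, hYy'.trans hy', fun s => (hY s).trans ?_⟩
  congr! 4 with r
  by_cases hr : r ∈ Icc P.t₀ t
  · rw [hYy' hr]
  · simp only [truncA, indicator_of_notMem hr, zero_apply]

theorem inTargetAt_iff_exists_bcf (ht : P.t₀ ≤ t) (hA : Integrable (P.truncA t))
    {u : ℝ → RSpace m} (hg : Integrable fun r => P.truncB t r (u r)) {x : RSpace n} :
    P.InTargetAt x u t ↔ ∃ z ∈ P.S, ∃ Y : ℝ →ᵇ RSpace n,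
      (∀ s, Y s = x + ∫ r in P.t₀..s, (P.truncA t r (Y r) + P.truncB t r (u r))) ∧
        Y t = z := by
  constructor
  · rintro ⟨y, hy, hyS⟩
    obtain ⟨Y, hYy, hY⟩ := hy.exists_bcf ht hA hg
    exact ⟨y t, hyS, Y, hY, hYy (right_mem_Icc.2 ht)⟩
  · rintro ⟨_, hz, Y, hY, rfl⟩
    exact ⟨Y, ⟨Y.continuous.continuousOn,
      fun s hs => (hY s).trans (by rw [integral_trunc _ _ hs])⟩, hz⟩

/-- `f ↦ y(t₀)`, where `y` solves the Volterra equation `y(s) = f(s) + ∫ r in t..s, A(r) y(r)`. -/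
noncomputable def backward (hA : Integrable (P.truncA t)) :
    (ℝ →ᵇ RSpace n) →L[ℝ] RSpace n :=
  BoundedContinuousFunction.evalCLM ℝ P.t₀ ∘L Ring.inverse (1 - volterra t hA)

/-- `w ↦ y(t₀)`, where `y` is the trajectory with control `w` and `y(t) = 0`. -/
noncomputable def controlToInitial (hA : Integrable (P.truncA t)) (hB : Integrable (P.truncB t)) :
    Lp (RSpace m) 2 (P.controlMeasure t) →L[ℝ] RSpace n :=
  backward hA ∘L primitive t ∘L applyL1 hB

theorem inTargetAt_iff (ht : P.t₀ ≤ t) (hA : Integrable (P.truncA t))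
    (hB : Integrable (P.truncB t)) {w : Lp (RSpace m) 2 (P.controlMeasure t)} {u : ℝ → RSpace m}
    (hwu : w =ᵐ[P.controlMeasure t] u) {x : RSpace n} :
    P.InTargetAt x u t ↔
      ∃ z ∈ P.S, backward hA (.const ℝ z) + controlToInitial hA hB w = x := by
  have hBu : applyL1 hB w =ᵐ[volume] fun r => P.truncB t r (u r) :=
    (coeFn_applyL1 hB w).trans (clm_apply_ae_eq hB.1 hwu)
  have hint : ∀ (Y : ℝ →ᵇ RSpace n) s,
      ∫ r in P.t₀..s, (P.truncA t r (Y r) + P.truncB t r (u r)) =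
        ∫ r in P.t₀..s, (P.truncA t r (Y r) + applyL1 hB w r) := fun Y s =>
    intervalIntegral.integral_congr_ae (hBu.mono fun r hr _ => by rw [hr])
  rw [inTargetAt_iff_exists_bcf ht hA ((L1.integrable_coeFn _).congr hBu)]
  refine exists_congr fun z => and_congr_right fun _ => ?_
  simp only [hint]
  rw [exists_solution_iff hA (applyL1 hB w), map_add]
  rfl

theorem reach_eq (hP : P.StandingAssumptions) (ht : P.t₀ ≤ t) :
    P.reach t =
      (fun z => backward (integrable_truncA hP ht) (.const ℝ z)) '' P.S +
        controlToInitial (integrable_truncA hP ht) (integrable_truncB hP ht) ''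
          lpWithValuesIn (P.controlMeasure t) 2 P.U := by
  have hiff := fun {w u} => inTargetAt_iff (w := w) (u := u) ht (integrable_truncA hP ht)
    (integrable_truncB hP ht)
  ext x
  rw [Set.mem_add]
  constructor
  · rintro ⟨u, hu, hxu⟩
    obtain ⟨w, hw, hwu⟩ := exists_lp_of_mem_admissible hP ht hu
    obtain ⟨z, hz, hx⟩ := (hiff hwu).1 hxu
    exact ⟨_, ⟨z, hz, rfl⟩, _, ⟨w, hw, rfl⟩, hx⟩
  · rintro ⟨_, ⟨z, hz, rfl⟩, _, ⟨w, hw, rfl⟩, hx⟩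
    obtain ⟨u, hu, hwu⟩ := exists_mem_admissible_of_lp hP hw
    exact ⟨u, hu, (hiff hwu).2 ⟨z, hz, hx⟩⟩

theorem isCompact_reach (hP : P.StandingAssumptions) (ht : P.t₀ ≤ t) :
    IsCompact (P.reach t) := by
  have := isFiniteMeasure_opNormMeasure (integrable_truncB hP ht)
  rw [reach_eq hP ht]
  exact (hP.isCompact_S.image ((backward _).continuous.comp continuous_bcf_const)).add
    (isCompact_clm_image _ (convex_lpWithValuesIn hP.convex_U)
      (isClosed_lpWithValuesIn hP.isCompact_U.isClosed)
      (isBounded_lpWithValuesIn hP.isCompact_U.isBounded))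

end ControlProblem

namespace ControlProblem

variable {n m : ℕ} {P : ControlProblem n m} {t : ℝ} {x : RSpace n}

theorem t₀_le_minTime : (P.t₀ : EReal) ≤ P.minTime x := by
  refine le_iInf₂ fun u _ => le_sInf ?_
  rintro _ ⟨t, ht, rfl⟩
  exact EReal.coe_le_coe_iff.2 ht.1

theorem minTime_le_of_mem_reach (ht : P.t₀ ≤ t) (hx : x ∈ P.reach t) : P.minTime x ≤ t := by
  obtain ⟨u, hu, hut⟩ := hx
  exact (iInf₂_le u hu).trans (sInf_le ⟨t, ⟨ht, hut⟩, rfl⟩)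

theorem subset_reach_t₀ (hU : P.U.Nonempty) : P.S ⊆ P.reach P.t₀ := by
  intro x hx
  obtain ⟨u₀, hu₀⟩ := hU
  refine ⟨fun _ => u₀, ⟨measurable_const, fun _ _ => hu₀⟩, fun _ => x,
    ⟨continuousOn_const, fun s hs => ?_⟩, hx⟩
  obtain rfl : s = P.t₀ := by simpa using hs
  rw [intervalIntegral.integral_same, add_zero]

theorem minTime_eq_of_mem_target (hU : P.U.Nonempty) (hx : x ∈ P.S) : P.minTime x = P.t₀ :=
  (minTime_le_of_mem_reach le_rfl (subset_reach_t₀ hU hx)).antisymm t₀_le_minTime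

theorem reach_nonempty (hP : P.StandingAssumptions) (ht : P.t₀ ≤ t) (htf : t ≤ P.tf) :
    (P.reach t).Nonempty := by
  have h0 := hP.nonempty_S.mono (subset_reach_t₀ hP.nonempty_U)
  rcases ht.eq_or_lt with rfl | hlt
  · exact h0
  · exact h0.mono ((hP.strictly_expanding _ _ le_rfl hlt htf).trans interior_subset)

theorem minTime_eq_of_mem_frontier_reach (hP : P.StandingAssumptions) (ht : P.t₀ ≤ t)
    (htf : t ≤ P.tf) (hx : x ∈ frontier (P.reach t)) : P.minTime x = t := by
  refine (minTime_le_of_mem_reach ht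
    ((isCompact_reach hP ht).isClosed.frontier_subset hx)).antisymm ?_
  refine le_iInf₂ fun u hu => le_sInf ?_
  rintro _ ⟨s, hs, rfl⟩
  refine EReal.coe_le_coe_iff.2 (not_lt.1 fun hst => hx.2 ?_)
  exact hP.strictly_expanding s t hs.1 hst htf ⟨u, hu, hs.2⟩

end ControlProblem

namespace DiscreteScheme

variable {n m : ℕ} {P : ControlProblem n m} (D : DiscreteScheme n m)

theorem dt_nonneg (htf : P.t₀ ≤ P.tf) : 0 ≤ D.dt P :=
  div_nonneg (sub_nonneg.2 htf) D.K.cast_nonneg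

theorem t₀_le_time (htf : P.t₀ ≤ P.tf) (i : ℕ) : P.t₀ ≤ D.time P i :=
  le_add_of_nonneg_right (mul_nonneg i.cast_nonneg (D.dt_nonneg htf))

theorem time_le_tf (htf : P.t₀ ≤ P.tf) {i : ℕ} (hi : i ≤ D.K) : D.time P i ≤ P.tf := by
  have hK : (D.K : ℝ) ≠ 0 := Nat.cast_ne_zero.2 D.K_pos.ne'
  calc D.time P i ≤ P.t₀ + D.K * D.dt P := by
        rw [time]
        gcongr
        exact D.dt_nonneg htf
    _ = P.tf := by rw [dt, mul_div_cancel₀ _ hK, add_sub_cancel]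

end DiscreteScheme

section Modulus

variable {E : Type*} [SeminormedAddCommGroup E] {ω : ℝ → ℝ} {f : E → ℝ} {s : Set E} {x y : E}
  {δ : ℝ}

/-- `ω` is a non-decreasing modulus of continuity of `f` on `s`; it need not tend to `0` at `0`. -/
structure IsModulusOn (ω : ℝ → ℝ) (f : E → ℝ) (s : Set E) : Prop where
  monotoneOn : MonotoneOn ω (Ici 0)
  abs_sub_le : ∀ x ∈ s, ∀ y ∈ s, |f x - f y| ≤ ω ‖x - y‖

theorem IsModulusOn.abs_sub_le_of_dist_le (hω : IsModulusOn ω f s) (hx : x ∈ s) (hy : y ∈ s)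
    (hxy : dist x y ≤ δ) : |f x - f y| ≤ ω δ := by
  rw [dist_eq_norm] at hxy
  exact (hω.abs_sub_le x hx y hy).trans
    (hω.monotoneOn (norm_nonneg _) ((norm_nonneg _).trans hxy) hxy)

theorem IsModulusOn.nonneg (hω : IsModulusOn ω f s) (hs : s.Nonempty) (hδ : 0 ≤ δ) : 0 ≤ ω δ := by
  obtain ⟨x, hx⟩ := hs
  exact (abs_nonneg _).trans (hω.abs_sub_le_of_dist_le hx hx (by rwa [dist_self]))

end Modulus

namespace AlgorithmRun

variable {n m : ℕ} {P : ControlProblem n m} {D : DiscreteScheme n m} (Z : AlgorithmRun P D)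
  {ω : ℝ → ℝ} {ε : ℝ} {i : ℕ} {x : RSpace n}

theorem isCompact_R (i : ℕ) : IsCompact (Z.R i) :=
  (finite_range (Z.y i)).isCompact_convexHull ℝ

theorem R_subset_Ω (hi : i ≤ D.K) : Z.R i ⊆ Z.Ω :=
  subset_biUnion_of_mem (u := Z.R) (mem_Iic.2 hi)

theorem R_zero_subset_target (hS : Convex ℝ P.S) : Z.R 0 ⊆ P.S := by
  refine convexHull_min ?_ hS
  rintro _ ⟨k, rfl⟩
  exact (Z.y_zero k).1

theorem mem_frontier_of_mem_Y (hi : i < D.K) (hx : x ∈ Z.Y (i + 1)) :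
    x ∈ frontier (Z.R (i + 1)) := by
  obtain ⟨k, rfl⟩ := hx
  have hR : Z.R (i + 1) ⊆ convexHull ℝ (D.step P i (range (Z.y i)) (range Z.u)) := by
    refine convexHull_min ?_ (convex_convexHull ℝ _)
    rintro _ ⟨κ, rfl⟩
    exact (Z.y_succ i hi κ).1
  have hl : innerSL ℝ (D.dirR k) ≠ 0 :=
    norm_ne_zero_iff.1 (by rw [innerSL_apply_norm, D.norm_dirR]; exact one_ne_zero)
  have hmax : IsMaxOn (innerSL ℝ (D.dirR k)) (Z.R (i + 1)) (Z.y (i + 1) k) := fun a ha =>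
    (Z.y_succ i hi k).2 a (hR ha)
  exact ⟨subset_closure (subset_convexHull ℝ _ ⟨k, rfl⟩), notMem_interior_of_isMaxOn hl hmax⟩

theorem mem_R_zero_or_onBoundary_of_mem_Y (hi : i ≤ D.K) (hx : x ∈ Z.Y i) :
    x ∈ Z.R 0 ∨ Z.OnBoundary x := by
  cases i with
  | zero => exact .inl (subset_convexHull ℝ _ hx)
  | succ i => exact .inr ⟨i + 1, i.succ_pos, hi, Z.mem_frontier_of_mem_Y hi hx⟩

theorem abs_minTime_sub_time_le (hP : P.StandingAssumptions)
    (hω : IsModulusOn ω (fun x => (P.minTime x).toReal) P.reachAll) (hΩ : Z.Ω ⊆ P.reachAll)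
    (hi : i ≤ D.K) (hε : Metric.hausdorffDist (Z.R i) (P.reach (D.time P i)) ≤ ε)
    (hx : x ∈ frontier (Z.R i)) : |(P.minTime x).toReal - D.time P i| ≤ ω ε := by
  have ht := D.t₀_le_time hP.t₀_lt_tf.le i
  have htf := D.time_le_tf hP.t₀_lt_tf.le hi
  have hcomp := ControlProblem.isCompact_reach hP ht
  obtain ⟨z, hz, hxz⟩ := exists_mem_frontier_dist_le_hausdorffDist (Z.isCompact_R i)
    (convex_convexHull ℝ _) hcomp (ControlProblem.reach_nonempty hP ht htf) hx
  have hxΩ : x ∈ Z.Ω := Z.R_subset_Ω hi ((Z.isCompact_R i).isClosed.frontier_subset hx)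
  have hzR : z ∈ P.reachAll :=
    mem_biUnion (t := P.reach) (mem_Ici.2 ht) (hcomp.isClosed.frontier_subset hz)
  have hzT : (P.minTime z).toReal = D.time P i := by
    rw [ControlProblem.minTime_eq_of_mem_frontier_reach hP ht htf hz, EReal.toReal_coe]
  rw [← hzT]
  exact hω.abs_sub_le_of_dist_le (hΩ hxΩ) hzR (hxz.trans hε)

end AlgorithmRun

namespace Triangulation

variable {n m : ℕ} {P : ControlProblem n m} {D : DiscreteScheme n m} {Z : AlgorithmRun P D}
  (G : Triangulation Z)

theorem maxDiam_nonneg : 0 ≤ G.maxDiam :=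
  Real.iSup_nonneg fun _ => Metric.diam_nonneg

theorem dist_le_maxDiam {j : Fin G.M} {x y : RSpace n} (hx : x ∈ G.cell j) (hy : y ∈ G.cell j) :
    dist x y ≤ G.maxDiam :=
  (Metric.dist_le_diam_of_mem ((finite_range _).isCompact_convexHull ℝ).isBounded hx hy).trans
    (le_ciSup (f := fun j => Metric.diam (G.cell j)) (finite_range _).bddAbove j)

theorem exists_mem_cell {x : RSpace n} (hx : x ∈ Z.Ω) (hxS : x ∉ P.S) : ∃ j, x ∈ G.cell j :=
  mem_iUnion.1 (G.covers ⟨hx, fun h => hxS (interior_subset h)⟩)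

end Triangulation

theorem exists_weights_of_mem_convexHull_range {ι E : Type*} [Fintype ι] [AddCommGroup E]
    [Module ℝ E] {v : ι → E} {x : E} (hx : x ∈ convexHull ℝ (range v)) :
    ∃ w : ι → ℝ, (∀ i, 0 ≤ w i) ∧ ∑ i, w i = 1 ∧ ∑ i, w i • v i = x := by
  classical
  have hv : v = Fintype.linearCombination ℝ v ∘ fun i => Pi.single i 1 := by
    ext i
    simp
  rw [hv, range_comp, ← LinearMap.image_convexHull, convexHull_rangle_single_eq_stdSimplex] at hx
  obtain ⟨w, ⟨hw, hw1⟩, rfl⟩ := hx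
  exact ⟨w, hw, hw1, rfl⟩

namespace IsDiscreteMinTime

variable {n m : ℕ} {P : ControlProblem n m} {D : DiscreteScheme n m} {Z : AlgorithmRun P D}
  {G : Triangulation Z} {T : RSpace n → ℝ} {ω : ℝ → ℝ} {ε : ℝ} {x : RSpace n}

theorem abs_minTime_sub_le_of_mem_R_zero_or_onBoundary (hT : IsDiscreteMinTime G T)
    (hP : P.StandingAssumptions)
    (hω : IsModulusOn ω (fun x => (P.minTime x).toReal) P.reachAll) (hΩ : Z.Ω ⊆ P.reachAll)
    (hε : ∀ i ≤ D.K, Metric.hausdorffDist (Z.R i) (P.reach (D.time P i)) ≤ ε)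
    (hx : x ∈ Z.R 0 ∨ Z.OnBoundary x) : |(P.minTime x).toReal - T x| ≤ ω ε := by
  by_cases hx0 : x ∈ Z.R 0
  · have hxS := Z.R_zero_subset_target hP.convex_S hx0
    rw [hT.on_target x hx0, ControlProblem.minTime_eq_of_mem_target hP.nonempty_U hxS,
      EReal.toReal_coe, sub_self, abs_zero]
    exact hω.nonneg ⟨x, hΩ (Z.R_subset_Ω D.K.zero_le hx0)⟩
      (Metric.hausdorffDist_nonneg.trans (hε 0 D.K.zero_le))
  · obtain ⟨i, -, hi, hxi, hTx⟩ := hT.on_boundary x hx0 (hx.resolve_left hx0)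
    rw [hTx]
    exact Z.abs_minTime_sub_time_le hP hω hΩ hi (hε i hi) hxi

theorem abs_minTime_sub_le_of_mem_cell (hT : IsDiscreteMinTime G T) (hP : P.StandingAssumptions)
    (hω : IsModulusOn ω (fun x => (P.minTime x).toReal) P.reachAll) (hΩ : Z.Ω ⊆ P.reachAll)
    (hε : ∀ i ≤ D.K, Metric.hausdorffDist (Z.R i) (P.reach (D.time P i)) ≤ ε)
    (hx : ¬(x ∈ Z.R 0 ∨ Z.OnBoundary x)) {j : Fin G.M} (hxj : x ∈ G.cell j) :
    |(P.minTime x).toReal - T x| ≤ ω G.maxDiam + ω ε := by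
  have hxΩ : x ∈ Z.Ω := G.subset_domain (mem_iUnion.2 ⟨j, hxj⟩)
  obtain ⟨w, hw, hw1, hwx⟩ := exists_weights_of_mem_convexHull_range hxj
  have hnode : ∀ ν, |(P.minTime x).toReal - T ((G.simplex j).points ν)| ≤
      ω G.maxDiam + ω ε := fun ν => by
    obtain ⟨i, hi, hνi⟩ := G.nodes j ν
    have hνΩ := Z.R_subset_Ω hi (subset_convexHull ℝ _ hνi)
    have hdist := G.dist_le_maxDiam hxj (subset_convexHull ℝ _ (mem_range_self ν))
    exact (abs_sub_le _ _ _).trans (add_le_add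
      (hω.abs_sub_le_of_dist_le (hΩ hxΩ) (hΩ hνΩ) hdist)
      (hT.abs_minTime_sub_le_of_mem_R_zero_or_onBoundary hP hω hΩ hε
        (Z.mem_R_zero_or_onBoundary_of_mem_Y hi hνi)))
  rw [not_or] at hx
  rw [hT.on_simplex x hxΩ hx.1 hx.2 j w hw hw1 hwx.symm, ← Real.dist_eq, ← Metric.mem_closedBall']
  refine (convex_closedBall _ _).sum_mem (fun ν _ => hw ν) hw1 fun ν _ => ?_
  exact Metric.mem_closedBall'.2 (hnode ν)

theorem eq_minTime_of_forall_notMem_cell (hT : IsDiscreteMinTime G T) (hU : P.U.Nonempty)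
    (hxΩ : x ∈ Z.Ω) (hx : ¬(x ∈ Z.R 0 ∨ Z.OnBoundary x)) (hxG : ∀ j, x ∉ G.cell j) :
    T x = (P.minTime x).toReal := by
  have hxS : x ∈ P.S := not_not.1 fun hxS => not_exists.2 hxG (G.exists_mem_cell hxΩ hxS)
  rw [not_or] at hx
  rw [hT.on_rest x hxΩ hx.1 hx.2 hxS hxG, ControlProblem.minTime_eq_of_mem_target hU hxS,
    EReal.toReal_coe]

end IsDiscreteMinTime

theorem theorem3p4 {n m : ℕ} (P : ControlProblem n m) (hP : P.StandingAssumptions)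
    (ω : ℝ → ℝ) (hω_mono : MonotoneOn ω (Set.Ici 0))
    (hω : ∀ x ∈ P.reachAll, ∀ y ∈ P.reachAll,
      |(P.minTime x).toReal - (P.minTime y).toReal| ≤ ω ‖x - y‖)
    (D : DiscreteScheme n m) (Z : AlgorithmRun P D) (G : Triangulation Z)
    (hΩ : Z.Ω ⊆ P.reachAll)
    (C p : ℝ)
    (hC : ∀ i ≤ D.K, Metric.hausdorffDist (Z.R i) (P.reach (D.time P i)) ≤ C * (D.h P) ^ p)
    (T_hΔ : RSpace n → ℝ) (hT : IsDiscreteMinTime G T_hΔ) :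
    supNormOn Z.Ω (fun x => (P.minTime x).toReal - T_hΔ x) ≤
      ENNReal.ofReal (ω G.maxDiam + ω (C * (D.h P) ^ p)) := by
  have hmod : IsModulusOn ω (fun x => (P.minTime x).toReal) P.reachAll := ⟨hω_mono, hω⟩
  refine iSup₂_le fun x hxΩ => ?_
  rw [← ofReal_norm, Real.norm_eq_abs]
  refine ENNReal.ofReal_le_ofReal ?_
  have hdiam : 0 ≤ ω G.maxDiam := hmod.nonneg ⟨x, hΩ hxΩ⟩ G.maxDiam_nonneg
  have hstep : 0 ≤ ω (C * (D.h P) ^ p) :=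
    hmod.nonneg ⟨x, hΩ hxΩ⟩ (Metric.hausdorffDist_nonneg.trans (hC 0 D.K.zero_le))
  by_cases hx : x ∈ Z.R 0 ∨ Z.OnBoundary x
  · exact (hT.abs_minTime_sub_le_of_mem_R_zero_or_onBoundary hP hmod hΩ hC hx).trans
      (le_add_of_nonneg_left hdiam)
  by_cases hxG : ∃ j, x ∈ G.cell j
  · exact hT.abs_minTime_sub_le_of_mem_cell hP hmod hΩ hC hx hxG.choose_spec
  · beta_reduce
    rw [hT.eq_minTime_of_forall_notMem_cell hP.nonempty_U hxΩ hx (not_exists.1 hxG), sub_self,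
      abs_zero]
    exact add_nonneg hdiam hstep
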